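/- Let $d\ge 1$ be fixed and, for $n\ge 2$, let $\mathcal C_n^d$ be the Cartesian product of $d$ copies of the cycle $\mathcal C_n$ with $n$ vertices (two vertices are adjacent, written $x\leftrightarrow y$, if they are adjacent in $\mathcal C_n$ in one coordinate and equal in all others; $\mathcal C_2$ is a single edge). Let $V_n$ be its vertex set, so $|V_n|=n^d$. The mass process $\mathcal M_t=(M^x_t)_{x\in V_n}$, $t\ge 0$, on $\mathcal C_n^d$ has values in $[0,\infty)^{V_n}$ and is driven by independent Poisson processes $N^v$, $v\in V_n$, of intensity $1$, independent of $\mathcal M_0$: when $N^v$ jumps at time $t$, the mass at $v$ becomes $0$ and the mass $M^v_{t-}$ is distributed equally among the neighbours of $v$, that is, $M^v_t=0$ and $M^x_t=M^x_{t-}+M^v_{t-}/\deg(v)$ for each $x\leftrightarrow v$; the masses do not change otherwise. For every $n\ge2$, let $\mathcal M$ be a mass process on $\mathcal C_n^d$ in the stationary regime (the law of $\mathcal M_t$ is the same law $Q_n$ for all $t\ge 0$) with $\sum_{x\in V_n}M^x_0=n^d$ almost surely. Then: 1. for every $n\ge 2$ and $x\in V_n$, $M^x_0$ is square integrable and $\mathbb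 E_{Q_n} M^x_0=1$; 2. $\lim_{n\to\infty}\operatorname{Var}_{Q_n}M^x_0=1$ for $x\in V_n$; 3. $\lim_{n\to\infty}\operatorname{Cov}_{Q_n}(M^x_0,M^y_0)=-\frac1{2d}$ for $x,y\in V_n$ with $x\leftrightarrow y$; 4. $\lim_{n\to\infty}\operatorname{Cov}_{Q_n}(M^x_0,M^y_0)=0$ for $x,y\in V_n$ with $x\ne y$ and $x\not\leftrightarrow y$. The limits in 2, 3 and 4 are uniform over all vertices $x$, respectively all pairs $(x,y)$, of the indicated kind in $V_n$. -/

import Mathlib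

open MeasureTheory ProbabilityTheory Filter Topology
open scoped NNReal

/-- The torus `C_n^d`: the Cartesian product of `d` copies of the cycle `C_n`. Two vertices are
joined by an edge when they are joined in the cycle in one coordinate and agree in all others.
(For `n = 2` the cycle is a single edge.) -/
def torusGraph (n d : ℕ) : SimpleGraph (Fin d → Fin n) where
  Adj x y := ∃ i, (SimpleGraph.cycleGraph n).Adj (x i) (y i) ∧ ∀ j, j ≠ i → x j = y j
  symm := ⟨fun _ _ ⟨i, hi, h⟩ => ⟨i, hi.symm, fun j hj => (h j hj).symm⟩⟩
  loopless := ⟨fun x ⟨i, hi, _⟩ => (SimpleGraph.cycleGraph n).loopless.irrefl (x i) hi⟩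

/-- `N` is a Poisson process of intensity 1 on `[0, ∞)`: it starts at `0`, has nondecreasing
right-continuous paths, and independent increments, the increment over `(s, t]` being Poisson
with mean `t - s`. (The truncated subtraction is harmless, the paths being nondecreasing.) -/
structure IsPoissonProcess {Ω : Type*} [MeasurableSpace Ω] (P : Measure Ω)
    (N : ℝ≥0 → Ω → ℕ) : Prop where
  measurable : ∀ t, Measurable (N t)
  start : ∀ᵐ ω ∂P, N 0 ω = 0
  mono : ∀ᵐ ω ∂P, Monotone fun t => N t ω
  rightCont : ∀ᵐ ω ∂P, ∀ t, ContinuousWithinAt (fun s => N s ω) (Set.Ici t) t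
  indep : HasIndepIncrements N P
  law : ∀ s t, s ≤ t → P.map (fun ω => N t ω - N s ω) = poissonMeasure (t - s)

open scoped Classical in
/-- A meteor hits `v`: the mass at `v` jumps to `0` and is distributed equally among the
neighbours of `v`. -/
noncomputable def meteorHit {V : Type*} (G : SimpleGraph V) (v : V) (m : V → ℝ) : V → ℝ :=
  fun x => if x = v then 0
    else if G.Adj v x then m x + m v / ((G.neighborSet v).ncard : ℝ)
    else m x

/-- `M` is the mass process on the graph `G` driven by the independent Poisson processes `N v` of
meteor arrivals. The vector of masses at time `t` is `M t ω`. The initial masses are nonnegative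
and independent of the arrivals. The masses are constant on every time interval `[s, t]` such that
no meteor arrives during `(s, t]`. If a meteor hits `v` at time `t > 0` (that is, `N v` jumps at
`t`), then the masses have a left limit at `t`, and `M t` arises from it by a hit at `v`. -/
structure IsMassProcess {V : Type*} (G : SimpleGraph V) {Ω : Type*} [MeasurableSpace Ω]
    (P : Measure Ω) (N : V → ℝ≥0 → Ω → ℕ) (M : ℝ≥0 → Ω → V → ℝ) : Prop where
  poisson : ∀ v, IsPoissonProcess P (N v)
  indep : iIndepFun (fun v ω t => N v t ω) P
  measurable : ∀ t, Measurable (M t)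
  indep_init : IndepFun (M 0) (fun ω v t => N v t ω) P
  nonneg_init : ∀ᵐ ω ∂P, ∀ v, 0 ≤ M 0 ω v
  const : ∀ᵐ ω ∂P, ∀ s t, s ≤ t → (∀ v, N v s ω = N v t ω) → M t ω = M s ω
  hit : ∀ᵐ ω ∂P, ∀ v t, 0 < t → (∀ s, s < t → N v s ω < N v t ω) →
    ∃ m, Tendsto (fun s => M s ω) (𝓝[<] t) (𝓝 m) ∧ M t ω = meteorHit G v m

/-- The mass process is stationary: `M t` has the same distribution at all times `t ≥ 0`, so that
the law of `M 0` is a stationary distribution of the mass process. -/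
def IsStationaryProcess {V Ω : Type*} [MeasurableSpace Ω] (P : Measure Ω)
    (M : ℝ≥0 → Ω → V → ℝ) : Prop :=
  ∀ t, P.map (M t) = P.map (M 0)

/-! No limit is really needed: on a connected `D`-regular graph the stationary second moments are
known exactly. Write L for `jumpRate`, the simple random walk matrix minus the identity. The total
mass is fixed, so the masses are bounded, and stationarity gives the generator identity
`sum_integral_meteorHit` for linear and quadratic test functions. Linear ones make the mean
L-harmonic, hence 1. Quadratic ones make (x, y) ↦ E[M^x M^y] an eigenvector of `pairMatrix`, the
matrix of two walkers driven by the same hits, with eigenvalue |V|. The vector 1 - L(x, y) is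
another one (`sum_pairMatrix_mul_one_sub_jumpRate`) with the same total |V|², and
`eigenvector_unique` applies because the walkers can coalesce. So the covariance is -L(x, y), which
on the torus with n ≥ 3 is 1, -1/(2d) or 0. -/

/-! ### Invariance of the stationary law under the generator -/

section Generator

variable {V Ω : Type*} [MeasurableSpace Ω] {P : Measure Ω} {G : SimpleGraph V}
  {N : V → ℝ≥0 → Ω → ℕ} {M : ℝ≥0 → Ω → V → ℝ}

/-- A monotone right-continuous `ℕ`-valued path that goes from `0` to `1` on `[0, t]` does so in
one jump. -/
lemma exists_jump_time {g : ℝ≥0 → ℕ} (h0 : g 0 = 0) (hm : Monotone g)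
    (hc : ∀ t, ContinuousWithinAt g (Set.Ici t) t) {t : ℝ≥0} (ht : g t = 1) :
    ∃ τ, 0 < τ ∧ τ ≤ t ∧ g τ = 1 ∧ ∀ s, s < τ → g s = 0 := by
  set S : Set ℝ≥0 := {s | 1 ≤ g s}
  have hS : t ∈ S := ht.ge
  have hlt : ∀ s, s < sInf S → g s = 0 := fun s hs => by
    by_contra h
    exact absurd (csInf_le (OrderBot.bddBelow S) (show s ∈ S from Nat.one_le_iff_ne_zero.2 h))
      (not_le.2 hs)
  have hle : sInf S ≤ t := csInf_le (OrderBot.bddBelow S) hS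
  -- The infimum is attained: by right-continuity a value 0 there would persist on an interval to
  -- its right, which meets `S`.
  have hge : 1 ≤ g (sInf S) := by
    by_contra h
    have hz : g (sInf S) = 0 := by omega
    have hev : ∀ᶠ s in 𝓝[Set.Ici (sInf S)] (sInf S), g s = 0 := by
      have h := hc (sInf S)
      rw [ContinuousWithinAt, hz, nhds_discrete, tendsto_pure] at h
      exact h
    obtain ⟨u, hu, hsub⟩ := (mem_nhdsGE_iff_exists_Ico_subset).1 hev
    obtain ⟨s, hsS, hsu⟩ := exists_lt_of_csInf_lt ⟨t, hS⟩ (show sInf S < u from hu)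
    have h1 : g s = 0 := hsub ⟨csInf_le (OrderBot.bddBelow S) hsS, hsu⟩
    have h2 : 1 ≤ g s := hsS
    omega
  have h1 : g (sInf S) = 1 := le_antisymm (ht ▸ hm hle) hge
  refine ⟨sInf S, ?_, hle, h1, hlt⟩
  rw [pos_iff_ne_zero]
  intro h
  rw [h, h0] at h1
  exact zero_ne_one h1

lemma IsMassProcess.eq_of_no_arrival [Countable V] (hM : IsMassProcess G P N M) (t : ℝ≥0) :
    ∀ᵐ ω ∂P, (∀ v, N v t ω = 0) → M t ω = M 0 ω := by
  filter_upwards [hM.const, ae_all_iff.2 fun v => (hM.poisson v).start] with ω hc h0 h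
  exact hc 0 t zero_le fun v => by rw [h0, h]

/-- Before the single jump time the masses are still the initial ones, so these are the left limit
to which the hit is applied; afterwards nothing changes up to `t`. -/
lemma IsMassProcess.eq_meteorHit_of_single_arrival [Countable V] [DecidableEq V]
    (hM : IsMassProcess G P N M) (t : ℝ≥0) :
    ∀ᵐ ω ∂P, ∀ v, (∀ w, N w t ω = if w = v then 1 else 0) → M t ω = meteorHit G v (M 0 ω) := by
  filter_upwards [hM.const, hM.hit, ae_all_iff.2 fun v => (hM.poisson v).start,
    ae_all_iff.2 fun v => (hM.poisson v).mono,
    ae_all_iff.2 fun v => (hM.poisson v).rightCont] with ω hc hh h0 hm hr v h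
  obtain ⟨τ, hτ, hτt, hτ1, hlt⟩ := exists_jump_time (h0 v) (hm v) (hr v) (by simpa using h v)
  have hother : ∀ w s, w ≠ v → s ≤ t → N w s ω = 0 := fun w s hw hs => by
    have := hm w hs
    simp only [h w, if_neg hw] at this
    omega
  obtain ⟨m, hlim, hMτ⟩ := hh v τ hτ fun s hs => by rw [hlt s hs, hτ1]; exact one_pos
  have hconst : ∀ s, s < τ → M s ω = M 0 ω := fun s hs => hc 0 s zero_le fun w => by
    by_cases hw : w = v
    · rw [hw, h0, hlt s hs]
    · rw [h0, hother w s hw (hs.le.trans hτt)]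
  have : (𝓝[<] τ).NeBot := nhdsLT_neBot_of_exists_lt ⟨0, hτ⟩
  have hm0 : m = M 0 ω := tendsto_nhds_unique hlim
    (tendsto_const_nhds.congr' (eventually_nhdsWithin_of_forall fun s hs => (hconst s hs).symm))
  rw [hc τ t hτt fun w => ?_, hMτ, hm0]
  by_cases hw : w = v
  · rw [h w, if_pos hw, hw, hτ1]
  · rw [hother w τ hw hτt, hother w t hw le_rfl]

lemma IsPoissonProcess.map_eq {N : ℝ≥0 → Ω → ℕ} (hN : IsPoissonProcess P N) (t : ℝ≥0) :
    P.map (N t) = poissonMeasure t := by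
  have := hN.law 0 t zero_le
  rw [tsub_zero] at this
  rw [← this]
  refine Measure.map_congr ?_
  filter_upwards [hN.start] with ω h
  simp [h]

lemma measurable_meteorHit (v : V) : Measurable (meteorHit G v) := by
  refine measurable_pi_lambda _ fun x => ?_
  unfold meteorHit
  split_ifs <;> fun_prop

variable [Fintype V]

lemma IsMassProcess.measureReal_arrivals (hM : IsMassProcess G P N M) (t : ℝ≥0) (a : V → ℕ) :
    P.real {ω | (fun v => N v t ω) = a}
      = ∏ v, (Real.exp (-t) * (t : ℝ) ^ a v / ((a v).factorial : ℝ)) := by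
  have h := hM.indep.meas_iInter (s := fun v => {ω | N v t ω = a v})
    fun v => ⟨(fun p : ℝ≥0 → ℕ => p t) ⁻¹' {a v}, (measurable_pi_apply t) (measurableSet_singleton _),
      rfl⟩
  have hset : {ω | (fun v => N v t ω) = a} = ⋂ v, {ω | N v t ω = a v} := by
    ext ω
    simp [funext_iff]
  rw [hset, measureReal_def, h, ENNReal.toReal_prod]
  refine Finset.prod_congr rfl fun v _ => ?_
  rw [← poissonMeasure_real_singleton, ← (hM.poisson v).map_eq t, measureReal_def,
    Measure.map_apply ((hM.poisson v).measurable t) (measurableSet_singleton _)]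
  rfl

/-- The initial masses are independent of the arrivals up to time `t`. -/
lemma IsMassProcess.integral_arrivals_mul (hM : IsMassProcess G P N M) (t : ℝ≥0) (a : V → ℕ)
    {f : (V → ℝ) → ℝ} (hf : Measurable f) :
    ∫ ω, {ω | (fun v => N v t ω) = a}.indicator 1 ω * f (M 0 ω) ∂P
      = P.real {ω | (fun v => N v t ω) = a} * ∫ ω, f (M 0 ω) ∂P := by
  have hpath : Measurable fun p : V → ℝ≥0 → ℕ => (fun v => p v t) := by fun_prop
  have hφ : Measurable (({a} : Set (V → ℕ)).indicator (1 : (V → ℕ) → ℝ) ∘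
      fun p : V → ℝ≥0 → ℕ => (fun v => p v t)) :=
    (measurable_one.indicator (measurableSet_singleton a)).comp hpath
  have hN : Measurable fun ω (v : V) => N v t ω :=
    measurable_pi_lambda _ fun v => (hM.poisson v).measurable t
  have hind : IndepFun ({ω | (fun v => N v t ω) = a}.indicator (1 : Ω → ℝ))
      (fun ω => f (M 0 ω)) P := (hM.indep_init.comp hf hφ).symm
  have hA : MeasurableSet {ω | (fun v => N v t ω) = a} := hN (measurableSet_singleton a)
  rw [hind.integral_fun_mul_eq_mul_integral
    (measurable_one.indicator hA).aestronglyMeasurable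
    (hf.comp (hM.measurable 0)).aestronglyMeasurable, integral_indicator_one hA]

/-- Bounds the probability that a Poisson variable of mean `s` is at least 2; multiply exp(-s) ≥ 1 -
s by 1 + s. -/
lemma one_sub_exp_le {s : ℝ} (hs : 0 ≤ s) : 1 - Real.exp (-s) * (1 + s) ≤ s ^ 2 := by
  nlinarith [Real.add_one_le_exp (-s)]

variable [IsProbabilityMeasure P]

/-- The error made by ignoring two or more arrivals in `[0, t]` is of order `t ^ 2`. -/
lemma IsMassProcess.abs_generator_le (hM : IsMassProcess G P N M)
    (hstat : IsStationaryProcess P M) {f : (V → ℝ) → ℝ} (hf : Measurable f) {C : ℝ}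
    (hC : ∀ᵐ ω ∂P, |f (M 0 ω)| ≤ C) (hC' : ∀ v, ∀ᵐ ω ∂P, |f (meteorHit G v (M 0 ω))| ≤ C)
    (t : ℝ≥0) :
    |∫ ω, f (M 0 ω) ∂P - Real.exp (-(Fintype.card V * t)) * ∫ ω, f (M 0 ω) ∂P
      - t * Real.exp (-(Fintype.card V * t)) * ∑ v, ∫ ω, f (meteorHit G v (M 0 ω)) ∂P|
      ≤ C * (Fintype.card V * t) ^ 2 := by
  classical
  set k : ℝ := (Fintype.card V : ℝ)
  have hk : 0 ≤ k := Nat.cast_nonneg _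
  set A : (V → ℕ) → Set Ω := fun a => {ω | (fun v => N v t ω) = a}
  set e : V → V → ℕ := fun v w => if w = v then 1 else 0
  have hN : Measurable fun ω (v : V) => N v t ω :=
    measurable_pi_lambda _ fun v => (hM.poisson v).measurable t
  have hA : ∀ a, MeasurableSet (A a) := fun a => hN (measurableSet_singleton a)
  have hexp : Real.exp (-(k * t)) = Real.exp (-(t : ℝ)) ^ Fintype.card V := by
    rw [← Real.exp_nat_mul]
    congr 1
    ring
  have hP0 : P.real (A 0) = Real.exp (-(k * t)) := by
    rw [hM.measureReal_arrivals, hexp]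
    simp
  have hP1 : ∀ v, P.real (A (e v)) = t * Real.exp (-(k * t)) := fun v => by
    rw [hM.measureReal_arrivals, hexp]
    have : ∀ w, Real.exp (-(t : ℝ)) * (t : ℝ) ^ e v w / ((e v w).factorial : ℝ)
        = Real.exp (-(t : ℝ)) * (if w = v then (t : ℝ) else 1) := fun w => by
      by_cases h : w = v <;> simp [e, h]
    simp_rw [this]
    rw [Finset.prod_mul_distrib, Finset.prod_ite_eq' Finset.univ v]
    simp [mul_comm]
  have hCt : ∀ᵐ ω ∂P, |f (M t ω)| ≤ C := by
    have hs : MeasurableSet {m : V → ℝ | |f m| ≤ C} := measurableSet_le (by fun_prop) (by fun_prop)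
    have h0 := (ae_map_iff (hM.measurable 0).aemeasurable hs).2 hC
    rw [← hstat t] at h0
    exact (ae_map_iff (hM.measurable t).aemeasurable hs).1 h0
  have hft : ∫ ω, f (M t ω) ∂P = ∫ ω, f (M 0 ω) ∂P := by
    rw [← integral_map (hM.measurable t).aemeasurable hf.aestronglyMeasurable, hstat t,
      integral_map (hM.measurable 0).aemeasurable hf.aestronglyMeasurable]
  have hint : ∀ g : Ω → ℝ, Measurable g → (∀ᵐ ω ∂P, |g ω| ≤ C) → Integrable g P :=
    fun g hg hb => Integrable.of_bound hg.aestronglyMeasurable C hb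
  have hit : Integrable (fun ω => f (M t ω)) P := hint _ (hf.comp (hM.measurable t)) hCt
  have hi0 : Integrable (fun ω => f (M 0 ω)) P := hint _ (hf.comp (hM.measurable 0)) hC
  have hi1 : ∀ v, Integrable (fun ω => f (meteorHit G v (M 0 ω))) P := fun v =>
    hint _ (hf.comp ((measurable_meteorHit v).comp (hM.measurable 0))) (hC' v)
  have hmul : ∀ a (g : Ω → ℝ), Integrable g P →
      Integrable (fun ω => (A a).indicator 1 ω * g ω) P := fun a g hg => by
    refine (hg.indicator (hA a)).congr (ae_of_all _ fun ω => ?_)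
    by_cases h : ω ∈ A a <;> simp [h]
  have hiA : ∀ a, Integrable ((A a).indicator (1 : Ω → ℝ)) P := fun a =>
    (integrable_const (1 : ℝ)).indicator (hA a)
  -- Both sides vanish when at most one meteor arrives; otherwise all indicators are 0 and the bound
  -- on `f (M t ω)` remains.
  have hpt : ∀ᵐ ω ∂P, ‖f (M t ω) - (A 0).indicator 1 ω * f (M 0 ω)
      - ∑ v, (A (e v)).indicator 1 ω * f (meteorHit G v (M 0 ω))‖
      ≤ C * (1 - (A 0).indicator 1 ω - ∑ v, (A (e v)).indicator 1 ω) := by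
    filter_upwards [hCt, hM.eq_of_no_arrival t, hM.eq_meteorHit_of_single_arrival t]
      with ω hb h0 h1
    by_cases hz : ω ∈ A 0
    · have hne : ∀ v, ω ∉ A (e v) := fun v hv => by
        have : (0 : V → ℕ) = e v := (show _ = _ from hz).symm.trans hv
        simpa [e] using congrFun this v
      simp [hz, hne, h0 fun v => congrFun (show _ = _ from hz) v]
    · by_cases hv : ∃ v, ω ∈ A (e v)
      · obtain ⟨v, hv⟩ := hv
        have hne : ∀ w, ω ∈ A (e w) ↔ w = v := fun w => by
          refine ⟨fun hw => ?_, fun h => h ▸ hv⟩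
          have : e w = e v := (show _ = _ from hw).symm.trans hv
          by_contra hwv
          simpa [e, hwv] using congrFun this w
        simp [hz, hne, Set.indicator_apply, h1 v fun w => congrFun (show _ = _ from hv) w]
      · push Not at hv
        simpa [hz, hv] using hb
  have hd : Integrable (fun ω => f (M t ω) - (A 0).indicator 1 ω * f (M 0 ω)) P :=
    hit.sub (hmul 0 _ hi0)
  have hs : Integrable (fun ω => ∑ v, (A (e v)).indicator 1 ω * f (meteorHit G v (M 0 ω))) P :=
    integrable_finsetSum _ fun v _ => hmul _ _ (hi1 v)
  have hd' : Integrable (fun ω => 1 - (A 0).indicator (1 : Ω → ℝ) ω) P :=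
    (integrable_const 1).sub (hiA 0)
  have hs' : Integrable (fun ω => ∑ v, (A (e v)).indicator (1 : Ω → ℝ) ω) P :=
    integrable_finsetSum _ fun v _ => hiA (e v)
  have hle := norm_integral_le_of_norm_le ((hd'.sub hs').const_mul C) hpt
  have hl : ∫ ω, (f (M t ω) - (A 0).indicator 1 ω * f (M 0 ω)
      - ∑ v, (A (e v)).indicator 1 ω * f (meteorHit G v (M 0 ω))) ∂P
      = ∫ ω, f (M 0 ω) ∂P - P.real (A 0) * ∫ ω, f (M 0 ω) ∂P
        - ∑ v, P.real (A (e v)) * ∫ ω, f (meteorHit G v (M 0 ω)) ∂P := by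
    rw [integral_sub hd hs, integral_sub hit (hmul 0 _ hi0),
      integral_finsetSum _ fun v _ => hmul _ _ (hi1 v), hft, hM.integral_arrivals_mul t 0 hf]
    congr 1
    exact Finset.sum_congr rfl fun v _ => hM.integral_arrivals_mul t (e v)
      (hf.comp (measurable_meteorHit v))
  have hr : ∫ ω, C * (1 - (A 0).indicator (1 : Ω → ℝ) ω
      - ∑ v, (A (e v)).indicator (1 : Ω → ℝ) ω) ∂P
      = C * (1 - P.real (A 0) - ∑ v, P.real (A (e v))) := by
    rw [integral_const_mul, integral_sub hd' hs', integral_sub (integrable_const _) (hiA 0),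
      integral_finsetSum _ fun v _ => hiA _]
    simp [integral_indicator_one (hA _)]
  rw [hl] at hle
  replace hle := hle.trans hr.le
  simp only [hP0, hP1, ← Finset.mul_sum, Real.norm_eq_abs, Finset.sum_const, Finset.card_univ,
    nsmul_eq_mul] at hle
  refine hle.trans (mul_le_mul_of_nonneg_left ?_ ?_)
  · have := one_sub_exp_le (s := k * t) (by positivity)
    linarith
  · obtain ⟨ω, h⟩ := hC.exists
    exact (abs_nonneg _).trans h

/-- The law of the initial masses of a stationary mass process is invariant under the generator. -/
theorem IsMassProcess.sum_integral_meteorHit (hM : IsMassProcess G P N M)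
    (hstat : IsStationaryProcess P M) {f : (V → ℝ) → ℝ} (hf : Measurable f) {C : ℝ}
    (hC : ∀ᵐ ω ∂P, |f (M 0 ω)| ≤ C) (hC' : ∀ v, ∀ᵐ ω ∂P, |f (meteorHit G v (M 0 ω))| ≤ C) :
    ∑ v, ∫ ω, f (meteorHit G v (M 0 ω)) ∂P = ∑ _v : V, ∫ ω, f (M 0 ω) ∂P := by
  rw [Finset.sum_const, Finset.card_univ, nsmul_eq_mul]
  have key := hM.abs_generator_le hstat hf hC hC'
  set k : ℝ := (Fintype.card V : ℝ)
  set a := ∫ ω, f (M 0 ω) ∂P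
  set b := ∑ v, ∫ ω, f (meteorHit G v (M 0 ω)) ∂P
  have hk : 0 ≤ k := Nat.cast_nonneg _
  -- This function is O(t²) as t ↓ 0 by `key`, so its derivative `k * a - b` at 0 must vanish.
  have hderiv : HasDerivAt (fun t : ℝ => a - Real.exp (-(k * t)) * a - t * Real.exp (-(k * t)) * b)
      (k * a - b) 0 := by
    have h1 : HasDerivAt (fun t : ℝ => Real.exp (-(k * t))) (-k) 0 := by
      simpa using ((hasDerivAt_id (0 : ℝ)).const_mul k).neg.exp
    have h2 := (((hasDerivAt_const (0 : ℝ) a).sub (h1.mul_const a)).sub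
      (((hasDerivAt_id (0 : ℝ)).mul h1).mul_const b))
    refine h2.congr_deriv ?_
    simp
  have hlim := (hasDerivAt_iff_tendsto_slope_zero.1 hderiv).mono_left
    (nhdsWithin_mono (0 : ℝ) (s := Set.Ioi 0) fun x hx => (ne_of_gt hx : x ≠ 0))
  have hzero : Tendsto (fun t : ℝ => C * k ^ 2 * t) (𝓝[>] 0) (𝓝 0) := by
    have : Continuous fun t : ℝ => C * k ^ 2 * t := by fun_prop
    simpa using this.continuousWithinAt.tendsto (x := (0 : ℝ)) (s := Set.Ioi 0)
  have h0 := squeeze_zero_norm' (f := fun t : ℝ => t⁻¹ • ((fun t : ℝ => a - Real.exp (-(k * t)) * a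
    - t * Real.exp (-(k * t)) * b) (0 + t) - (fun t : ℝ => a - Real.exp (-(k * t)) * a
    - t * Real.exp (-(k * t)) * b) 0)) (eventually_nhdsWithin_of_forall fun t (ht : 0 < t) => ?_) hzero
  · linarith [tendsto_nhds_unique hlim h0]
  · have := key ⟨t, ht.le⟩
    change |_ - Real.exp (-(k * t)) * a - t * Real.exp (-(k * t)) * b| ≤ C * (k * t) ^ 2 at this
    simp only [zero_add, mul_zero, neg_zero, Real.exp_zero, one_mul, zero_mul, sub_self, sub_zero,
      smul_eq_mul, norm_mul, norm_inv, Real.norm_eq_abs, abs_of_pos ht]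
    rw [inv_mul_le_iff₀ ht]
    calc _ ≤ _ := this
      _ = _ := by ring

end Generator

/-! ### Uniqueness of Perron eigenvectors -/

section Perron

variable {I : Type*} [Fintype I] {T : I → I → ℝ} {k : ℝ}

/-- The positive part u⁺ satisfies k u⁺ ≤ T u⁺ entrywise, and the constant column sums give both
sides the same total. Hence u⁺ is itself an eigenvector, and its positivity spreads along positive
entries of `T`. -/
lemma pos_of_eigenvector_of_reachable (hT : ∀ i j, 0 ≤ T i j) (hcol : ∀ j, ∑ i, T i j = k) {i₀ : I}
    {u : I → ℝ} (hu : ∀ i, ∑ j, T i j * u j = k * u i) {j : I}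
    (hreach : Relation.ReflTransGen (fun j i => 0 < T i j) j i₀) (hj : 0 < u j) : 0 < u i₀ := by
  have hk : 0 ≤ k := hcol j ▸ Finset.sum_nonneg fun i _ => hT i j
  have hle : ∀ i, k * max (u i) 0 ≤ ∑ j, T i j * max (u j) 0 := fun i => by
    rcases le_total (u i) 0 with h | h
    · rw [max_eq_right h, mul_zero]
      exact Finset.sum_nonneg fun j _ => mul_nonneg (hT i j) (le_max_right _ _)
    · rw [max_eq_left h, ← hu i]
      exact Finset.sum_le_sum fun j _ => mul_le_mul_of_nonneg_left (le_max_left _ _) (hT i j)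
  have hsum : ∑ i, k * max (u i) 0 = ∑ i, ∑ j, T i j * max (u j) 0 := by
    rw [Finset.sum_comm]
    simp_rw [← Finset.sum_mul, hcol]
  have heq := (Finset.sum_eq_sum_iff_of_le fun i _ => hle i).1 hsum
  suffices 0 < max (u i₀) 0 by simpa using this
  induction hreach with
  | refl => simpa using hj
  | @tail b c _ hbc ih =>
    have h1 : T c b * max (u b) 0 ≤ ∑ j, T c j * max (u j) 0 :=
      Finset.single_le_sum (f := fun j => T c j * max (u j) 0)
        (fun j _ => mul_nonneg (hT c j) (le_max_right _ _)) (Finset.mem_univ b)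
    rw [← heq c (Finset.mem_univ c)] at h1
    exact pos_of_mul_pos_right ((mul_pos hbc ih).trans_le h1) hk

/-- A nonnegative matrix with constant column sums `k`, from all of whose states a common state can
be reached, has at most one `k`-eigenvector of given total mass. -/
lemma eigenvector_unique (hT : ∀ i j, 0 ≤ T i j) (hcol : ∀ j, ∑ i, T i j = k) {i₀ : I}
    (hreach : ∀ j, Relation.ReflTransGen (fun j i => 0 < T i j) j i₀)
    {u w : I → ℝ} (hu : ∀ i, ∑ j, T i j * u j = k * u i) (hw : ∀ i, ∑ j, T i j * w j = k * w i)
    (hsum : ∑ i, u i = ∑ i, w i) : u = w := by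
  -- A strict excess anywhere forces one at `i₀`, so the comparison at `i₀` orders the two vectors
  -- everywhere; equal totals then make them equal.
  have key : ∀ u w : I → ℝ, (∀ i, ∑ j, T i j * u j = k * u i) →
      (∀ i, ∑ j, T i j * w j = k * w i) → ∀ j, w j < u j → w i₀ < u i₀ := fun u w hu hw j h => by
    have := pos_of_eigenvector_of_reachable hT hcol (u := fun i => u i - w i)
      (fun i => by simp_rw [mul_sub, Finset.sum_sub_distrib, hu, hw]) (hreach j) (sub_pos.2 h)
    exact sub_pos.1 this
  rcases le_total (w i₀) (u i₀) with h | h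
  · have hle : ∀ j, w j ≤ u j := fun j => not_lt.1 fun hj => (key w u hw hu j hj).not_ge h
    exact funext fun i => ((Finset.sum_eq_sum_iff_of_le fun i _ => hle i).1 hsum.symm i
      (Finset.mem_univ i)).symm
  · have hle : ∀ j, u j ≤ w j := fun j => not_lt.1 fun hj => (key u w hu hw j hj).not_ge h
    exact funext fun i => (Finset.sum_eq_sum_iff_of_le fun i _ => hle i).1 hsum i
      (Finset.mem_univ i)

end Perron

/-! ### Hits on a regular graph and the two-walker matrix -/

section RegularGraph

variable {V : Type*} (G : SimpleGraph V) (D : ℕ)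

open scoped Classical in
/-- The change of mass at `x` when a unit mass at `v` is hit, on a `D`-regular graph. -/
noncomputable def jumpRate (v x : V) : ℝ :=
  (if G.Adj v x then 1 / (D : ℝ) else 0) - if v = x then 1 else 0

open scoped Classical in
/-- The mass at `x` after a hit at `v`, starting with a unit mass at `z`. -/
noncomputable def hitCoeff (v z x : V) : ℝ :=
  (if z = x then 1 else 0) + if z = v then jumpRate G D v x else 0

lemma jumpRate_comm (v x : V) : jumpRate G D v x = jumpRate G D x v := by
  unfold jumpRate
  congr 2
  · exact propext (G.adj_comm v x)
  · exact propext eq_comm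

lemma jumpRate_self (v : V) : jumpRate G D v v = -1 := by
  simp [jumpRate]

lemma jumpRate_of_adj {v x : V} (h : G.Adj v x) : jumpRate G D v x = 1 / D := by
  simp [jumpRate, h, h.ne]

lemma jumpRate_of_not_adj {v x : V} (hne : v ≠ x) (h : ¬ G.Adj v x) : jumpRate G D v x = 0 := by
  simp [jumpRate, h, hne]

lemma hitCoeff_nonneg (v z x : V) : 0 ≤ hitCoeff G D v z x := by
  unfold hitCoeff jumpRate
  split_ifs <;> simp_all

lemma hitCoeff_of_ne {v z : V} (h : z ≠ v) : hitCoeff G D v z z = 1 := by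
  simp [hitCoeff, h]

lemma hitCoeff_of_adj {v x : V} (h : G.Adj v x) : hitCoeff G D v v x = 1 / D := by
  simp [hitCoeff, h.ne, jumpRate_of_adj G D h]

variable {G D} [Fintype V]

lemma sum_jumpRate (hD : 0 < D) (hreg : ∀ v, (G.neighborSet v).ncard = D) (v : V) :
    ∑ x, jumpRate G D v x = 0 := by
  classical
  have hcard : ((Finset.univ.filter fun x => G.Adj v x).card : ℝ) = D := by
    rw [← hreg v, Set.ncard_eq_toFinset_card', ← G.neighborFinset_eq_filter]
    rfl
  have : (D : ℝ) ≠ 0 := by positivity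
  simp only [jumpRate, Finset.sum_sub_distrib, Finset.sum_ite_eq, Finset.mem_univ, if_true]
  rw [← Finset.sum_filter, Finset.sum_const, nsmul_eq_mul, hcard]
  field_simp
  simp

lemma sum_jumpRate_left (hD : 0 < D) (hreg : ∀ v, (G.neighborSet v).ncard = D) (x : V) :
    ∑ v, jumpRate G D v x = 0 := by
  simp_rw [jumpRate_comm G D _ x, sum_jumpRate hD hreg]

lemma sum_hitCoeff (hD : 0 < D) (hreg : ∀ v, (G.neighborSet v).ncard = D) (v z : V) :
    ∑ x, hitCoeff G D v z x = 1 := by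
  classical
  simp only [hitCoeff, Finset.sum_add_distrib, Finset.sum_ite_eq, Finset.mem_univ, if_true]
  split_ifs <;> simp [sum_jumpRate hD hreg]

lemma sum_hitCoeff_mul (v x : V) (m : V → ℝ) :
    ∑ z, hitCoeff G D v z x * m z = m x + jumpRate G D v x * m v := by
  classical
  simp [hitCoeff, add_mul, Finset.sum_add_distrib, ite_mul]

lemma meteorHit_eq (hreg : ∀ v, (G.neighborSet v).ncard = D) (v : V) (m : V → ℝ) (x : V) :
    meteorHit G v m x = ∑ z, hitCoeff G D v z x * m z := by
  rw [sum_hitCoeff_mul]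
  unfold meteorHit jumpRate
  rw [hreg]
  rcases eq_or_ne x v with rfl | h
  · simp
  · by_cases hadj : G.Adj v x
    · simp [h, h.symm, hadj, div_eq_inv_mul]
    · simp [h, h.symm, hadj]

lemma meteorHit_nonneg (hreg : ∀ v, (G.neighborSet v).ncard = D) (v : V) {m : V → ℝ}
    (hm : ∀ x, 0 ≤ m x) (x : V) : 0 ≤ meteorHit G v m x := by
  rw [meteorHit_eq hreg]
  exact Finset.sum_nonneg fun z _ => mul_nonneg (hitCoeff_nonneg G D v z x) (hm z)

lemma sum_meteorHit (hD : 0 < D) (hreg : ∀ v, (G.neighborSet v).ncard = D) (v : V) (m : V → ℝ) :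
    ∑ x, meteorHit G v m x = ∑ x, m x := by
  simp_rw [meteorHit_eq hreg]
  rw [Finset.sum_comm]
  simp_rw [← Finset.sum_mul, sum_hitCoeff hD hreg, one_mul]

/-- Functions that are harmonic for the simple random walk on a connected regular graph are
constant. -/
lemma eq_of_sum_jumpRate_mul_eq_zero (hD : 0 < D) (hreg : ∀ v, (G.neighborSet v).ncard = D)
    (hconn : G.Connected) {m : V → ℝ} (hm : ∀ x, ∑ v, jumpRate G D v x * m v = 0) (x y : V) :
    m x = m y := by
  classical
  refine (G.lapMatrix_mulVec_eq_zero_iff_forall_reachable (x := m)).1 (funext fun x => ?_) x y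
    (hconn.preconnected x y)
  have hdeg : G.degree x = D := by
    rw [← hreg x, Set.ncard_eq_toFinset_card']
    rfl
  have hD' : (D : ℝ) ≠ 0 := by positivity
  have h := hm x
  simp_rw [jumpRate_comm G D _ x, jumpRate, sub_mul, ite_mul, zero_mul, one_mul,
    Finset.sum_sub_distrib, Finset.sum_ite_eq, Finset.mem_univ, if_true] at h
  rw [← Finset.sum_filter, ← Finset.mul_sum, ← G.neighborFinset_eq_filter] at h
  rw [G.lapMatrix_mulVec_apply, hdeg, Pi.zero_apply]
  field_simp at h
  linarith

/-- The transition matrix, summed over all hits, of a pair of particles that are moved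
independently to neighbours when the site that they occupy is hit. -/
noncomputable def pairMatrix (G : SimpleGraph V) (D : ℕ) (i j : V × V) : ℝ :=
  ∑ v, hitCoeff G D v j.1 i.1 * hitCoeff G D v j.2 i.2

lemma pairMatrix_nonneg (i j : V × V) : 0 ≤ pairMatrix G D i j :=
  Finset.sum_nonneg fun _ _ => mul_nonneg (hitCoeff_nonneg ..) (hitCoeff_nonneg ..)

lemma sum_pairMatrix (hD : 0 < D) (hreg : ∀ v, (G.neighborSet v).ncard = D) (j : V × V) :
    ∑ i, pairMatrix G D i j = Fintype.card V := by
  simp_rw [pairMatrix]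
  rw [Finset.sum_comm]
  simp_rw [Fintype.sum_prod_type, ← Finset.mul_sum, ← Finset.sum_mul, sum_hitCoeff hD hreg]
  simp

lemma pairMatrix_pos_of_hit {i j : V × V} {v : V} (h1 : 0 < hitCoeff G D v j.1 i.1)
    (h2 : 0 < hitCoeff G D v j.2 i.2) : 0 < pairMatrix G D i j :=
  (mul_pos h1 h2).trans_le (Finset.single_le_sum
    (f := fun v => hitCoeff G D v j.1 i.1 * hitCoeff G D v j.2 i.2)
    (fun _ _ => mul_nonneg (hitCoeff_nonneg ..) (hitCoeff_nonneg ..)) (Finset.mem_univ v))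

/-- The first walker goes to the second, which stays put while other sites are hit. Once together,
one hit can move both to the same neighbour, so the merged pair travels to `z`. -/
lemma pairMatrix_reachable (hD : 0 < D) (hconn : G.Connected) (z : V) (j : V × V) :
    Relation.ReflTransGen (fun j i => 0 < pairMatrix G D i j) j (z, z) := by
  have hadj : ∀ {v x}, G.Adj v x → 0 < hitCoeff G D v v x := fun h => by
    rw [hitCoeff_of_adj G D h]
    positivity
  obtain ⟨x, y⟩ := j
  refine Relation.ReflTransGen.trans (b := (y, y)) ?_ ?_
  · have h := (G.reachable_iff_reflTransGen x y).1 (hconn.preconnected x y)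
    induction h using Relation.ReflTransGen.head_induction_on with
    | refl => exact .refl
    | @head a b hab _ ih =>
      -- If the path is already at `y`, the walkers have met; a hit there would move both.
      rcases eq_or_ne y a with rfl | hne
      · exact .refl
      · refine Relation.ReflTransGen.head ?_ ih
        exact pairMatrix_pos_of_hit (v := a) (hadj hab) (by
          rw [hitCoeff_of_ne G D hne]
          exact one_pos)
  · have h := (G.reachable_iff_reflTransGen y z).1 (hconn.preconnected y z)
    exact h.lift (fun x => (x, x))
      fun a b hab => pairMatrix_pos_of_hit (v := a) (hadj hab) (hadj hab)

lemma sum_pairMatrix_mul (c : V → V → ℝ) (i : V × V) :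
    ∑ j, pairMatrix G D i j * c j.1 j.2
      = ∑ v, ∑ z, ∑ w, hitCoeff G D v z i.1 * hitCoeff G D v w i.2 * c z w := by
  simp_rw [pairMatrix, Finset.sum_mul]
  rw [Finset.sum_comm]
  simp_rw [Fintype.sum_prod_type]

/-- In the contribution of a hit at v, the products L(v, x) L(v, y) cancel because 1 - L(v, v) = 2.
What is left is linear in L and sums to 0 over v. -/
lemma sum_pairMatrix_mul_one_sub_jumpRate (hD : 0 < D)
    (hreg : ∀ v, (G.neighborSet v).ncard = D) (i : V × V) :
    ∑ j, pairMatrix G D i j * (1 - jumpRate G D j.1 j.2)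
      = Fintype.card V * (1 - jumpRate G D i.1 i.2) := by
  rw [sum_pairMatrix_mul fun x y => 1 - jumpRate G D x y]
  simp_rw [mul_assoc, ← Finset.mul_sum, sum_hitCoeff_mul, jumpRate_self]
  have : ∀ v, 1 - jumpRate G D i.1 i.2 + jumpRate G D v i.2 * (1 - jumpRate G D i.1 v)
      + jumpRate G D v i.1 * (1 - jumpRate G D v i.2 + jumpRate G D v i.2 * (1 - -1))
      = 1 - jumpRate G D i.1 i.2 + jumpRate G D v i.2 + jumpRate G D v i.1 := fun v => by
    rw [jumpRate_comm G D i.1 v]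
    ring
  simp_rw [this, Finset.sum_add_distrib, sum_jumpRate_left hD hreg]
  simp [mul_sub]

end RegularGraph

/-! ### First and second moments of the stationary masses -/

section Moments

variable {V Ω : Type*} [Fintype V] [MeasurableSpace Ω] {P : Measure Ω}
  {G : SimpleGraph V} {D : ℕ} {N : V → ℝ≥0 → Ω → ℕ} {M : ℝ≥0 → Ω → V → ℝ}

/-- A hit preserves nonnegativity and total mass; the resulting bound admits polynomials as test
functions in the generator identity. -/
lemma IsMassProcess.ae_abs_meteorHit_le (hD : 0 < D)
    (hreg : ∀ v, (G.neighborSet v).ncard = D) (hM : IsMassProcess G P N M)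
    (hmass : ∀ᵐ ω ∂P, ∑ x, M 0 ω x = Fintype.card V) (v x : V) :
    ∀ᵐ ω ∂P, |meteorHit G v (M 0 ω) x| ≤ Fintype.card V := by
  filter_upwards [hM.nonneg_init, hmass] with ω h0 hs
  rw [abs_of_nonneg (meteorHit_nonneg hreg v h0 x), ← hs, ← sum_meteorHit hD hreg v]
  exact Finset.single_le_sum (fun y _ => meteorHit_nonneg hreg v h0 y) (Finset.mem_univ x)

lemma IsMassProcess.ae_abs_le (hM : IsMassProcess G P N M)
    (hmass : ∀ᵐ ω ∂P, ∑ x, M 0 ω x = Fintype.card V) (x : V) :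
    ∀ᵐ ω ∂P, |M 0 ω x| ≤ Fintype.card V := by
  filter_upwards [hM.nonneg_init, hmass] with ω h0 hs
  rw [abs_of_nonneg (h0 x), ← hs]
  exact Finset.single_le_sum (fun y _ => h0 y) (Finset.mem_univ x)

variable [IsProbabilityMeasure P]

lemma IsMassProcess.memLp (hM : IsMassProcess G P N M)
    (hmass : ∀ᵐ ω ∂P, ∑ x, M 0 ω x = Fintype.card V) (x : V) (p : ENNReal) :
    MemLp (fun ω => M 0 ω x) p P := by
  exact MemLp.of_bound ((measurable_pi_apply x).comp (hM.measurable 0)).aestronglyMeasurable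
    (Fintype.card V : ℝ) (hM.ae_abs_le hmass x)

theorem IsMassProcess.integral_eq_one (hD : 0 < D)
    (hreg : ∀ v, (G.neighborSet v).ncard = D) (hconn : G.Connected) (hM : IsMassProcess G P N M)
    (hstat : IsStationaryProcess P M) (hmass : ∀ᵐ ω ∂P, ∑ x, M 0 ω x = Fintype.card V) (x : V) :
    ∫ ω, M 0 ω x ∂P = 1 := by
  have hint : ∀ x, Integrable (fun ω => M 0 ω x) P := fun x =>
    memLp_one_iff_integrable.1 (hM.memLp hmass x 1)
  have hgen : ∀ x, ∑ v, jumpRate G D v x * ∫ ω, M 0 ω v ∂P = 0 := fun x => by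
    have h := hM.sum_integral_meteorHit hstat (f := fun m => m x) (measurable_pi_apply x)
      (hM.ae_abs_le hmass x) fun v => hM.ae_abs_meteorHit_le hD hreg hmass v x
    simp_rw [meteorHit_eq hreg, sum_hitCoeff_mul] at h
    simp_rw [integral_add (hint x) ((hint _).const_mul _), integral_const_mul,
      Finset.sum_add_distrib] at h
    linarith
  have hconst := eq_of_sum_jumpRate_mul_eq_zero hD hreg hconn hgen
  have hsum : ∑ y, ∫ ω, M 0 ω y ∂P = Fintype.card V := by
    rw [← integral_finsetSum _ fun y _ => hint y, integral_congr_ae hmass]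
    simp
  simp_rw [hconst _ x] at hsum
  have : (Fintype.card V : ℝ) ≠ 0 := by
    have := hconn.nonempty
    exact_mod_cast Fintype.card_ne_zero
  simpa [this] using hsum

theorem IsMassProcess.integral_mul_eq (hD : 0 < D)
    (hreg : ∀ v, (G.neighborSet v).ncard = D) (hconn : G.Connected) (hM : IsMassProcess G P N M)
    (hstat : IsStationaryProcess P M) (hmass : ∀ᵐ ω ∂P, ∑ x, M 0 ω x = Fintype.card V)
    (x y : V) : ∫ ω, M 0 ω x * M 0 ω y ∂P = 1 - jumpRate G D x y := by
  have hint : ∀ x y, Integrable (fun ω => M 0 ω x * M 0 ω y) P := fun x y =>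
    (hM.memLp hmass x 2).integrable_mul (hM.memLp hmass y 2)
  have hgen : ∀ i : V × V, ∑ j, pairMatrix G D i j * ∫ ω, M 0 ω j.1 * M 0 ω j.2 ∂P
      = Fintype.card V * ∫ ω, M 0 ω i.1 * M 0 ω i.2 ∂P := fun i => by
    have h := hM.sum_integral_meteorHit hstat (f := fun m => m i.1 * m i.2)
      (C := Fintype.card V * Fintype.card V) (by fun_prop)
      (by
        filter_upwards [hM.ae_abs_le hmass i.1, hM.ae_abs_le hmass i.2] with ω h1 h2
        rw [abs_mul]
        gcongr)
      fun v => by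
        filter_upwards [hM.ae_abs_meteorHit_le hD hreg hmass v i.1,
          hM.ae_abs_meteorHit_le hD hreg hmass v i.2] with ω h1 h2
        rw [abs_mul]
        gcongr
    rw [Finset.sum_const, Finset.card_univ, nsmul_eq_mul] at h
    rw [sum_pairMatrix_mul fun z w => ∫ ω, M 0 ω z * M 0 ω w ∂P, ← h]
    refine Finset.sum_congr rfl fun v _ => ?_
    simp_rw [meteorHit_eq hreg, Finset.sum_mul_sum, mul_mul_mul_comm _ (M 0 _ _)]
    rw [integral_finsetSum _ fun z _ => integrable_finsetSum _ fun w _ => (hint z w).const_mul _]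
    refine Finset.sum_congr rfl fun z _ => ?_
    rw [integral_finsetSum _ fun w _ => (hint z w).const_mul _]
    simp_rw [integral_const_mul]
  -- Both totals are |V|²: the left is the mean squared total mass, and on the right the rows of L
  -- sum to 0.
  have hsum : ∑ i : V × V, ∫ ω, M 0 ω i.1 * M 0 ω i.2 ∂P
      = ∑ i : V × V, (1 - jumpRate G D i.1 i.2) := by
    rw [← integral_finsetSum _ fun i _ => hint i.1 i.2]
    have hsq : ∀ᵐ ω ∂P, ∑ i : V × V, M 0 ω i.1 * M 0 ω i.2
        = (Fintype.card V : ℝ) * Fintype.card V := by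
      filter_upwards [hmass] with ω h
      rw [← h, Finset.sum_mul_sum, Fintype.sum_prod_type]
    rw [integral_congr_ae hsq, Fintype.sum_prod_type]
    simp [Finset.sum_sub_distrib, sum_jumpRate hD hreg]
  obtain ⟨z⟩ := hconn.nonempty
  exact congrFun (eigenvector_unique pairMatrix_nonneg (sum_pairMatrix hD hreg)
    (pairMatrix_reachable hD hconn z) hgen (sum_pairMatrix_mul_one_sub_jumpRate hD hreg) hsum)
    (x, y)

/-- The covariances of a stationary mass process on a connected regular graph. -/
theorem IsMassProcess.covariance_eq (hD : 0 < D)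
    (hreg : ∀ v, (G.neighborSet v).ncard = D) (hconn : G.Connected) (hM : IsMassProcess G P N M)
    (hstat : IsStationaryProcess P M) (hmass : ∀ᵐ ω ∂P, ∑ x, M 0 ω x = Fintype.card V)
    (x y : V) : cov[fun ω => M 0 ω x, fun ω => M 0 ω y; P] = -jumpRate G D x y := by
  rw [covariance_eq_sub (hM.memLp hmass x 2) (hM.memLp hmass y 2),
    hM.integral_eq_one hD hreg hconn hstat hmass, hM.integral_eq_one hD hreg hconn hstat hmass]
  have := hM.integral_mul_eq hD hreg hconn hstat hmass x y
  simp only [Pi.mul_apply, this]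
  ring

end Moments

/-! ### Connectedness and degrees of the torus -/

section Torus

variable {n d : ℕ}

lemma torusGraph_reachable_update (x : Fin d → Fin n) (i : Fin d) (a : Fin n) :
    (torusGraph n d).Reachable x (Function.update x i a) := by
  let f : SimpleGraph.cycleGraph n →g torusGraph n d :=
    { toFun := fun b => Function.update x i b
      map_rel' := fun {b c} h => ⟨i, by simpa using h, fun j hj => by simp [hj]⟩ }
  have h := (SimpleGraph.cycleGraph_preconnected (x i) a).map f
  have hx : f (x i) = x := Function.update_eq_self i x
  rwa [hx] at h

lemma torusGraph_connected (hn : 1 ≤ n) : (torusGraph n d).Connected := by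
  have : NeZero n := ⟨by omega⟩
  refine (SimpleGraph.connected_iff _).2 ⟨fun x y => ?_, ⟨fun _ => 0⟩⟩
  -- The coordinates of `x` are replaced by those of `y` one at a time.
  have h : ∀ s : Finset (Fin d), (torusGraph n d).Reachable x (s.piecewise y x) := fun s => by
    induction s using Finset.induction_on with
    | empty => simp
    | insert i s _ ih =>
      rw [Finset.piecewise_insert]
      exact ih.trans (torusGraph_reachable_update _ i _)
  simpa using h Finset.univ

lemma torusGraph_neighborSet (x : Fin d → Fin n) :
    (torusGraph n d).neighborSet x
      = ⋃ i, Function.update x i '' (SimpleGraph.cycleGraph n).neighborSet (x i) := by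
  ext y
  simp only [SimpleGraph.mem_neighborSet, Set.mem_iUnion, Set.mem_image, torusGraph]
  refine exists_congr fun i => ⟨fun ⟨h, hj⟩ => ⟨y i, h, ?_⟩, ?_⟩
  · ext1 j
    rcases eq_or_ne j i with rfl | hne
    · simp
    · simp [hne, hj j hne]
  · rintro ⟨a, h, rfl⟩
    exact ⟨by simpa using h, fun j hj => by simp [hj]⟩

lemma torusGraph_ncard_neighborSet {r : ℕ}
    (hr : ∀ a, ((SimpleGraph.cycleGraph n).neighborSet a).ncard = r) (x : Fin d → Fin n) :
    ((torusGraph n d).neighborSet x).ncard = d * r := by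
  rw [torusGraph_neighborSet, Set.ncard_iUnion_of_finite]
  · rw [finsum_eq_sum_of_fintype, Finset.sum_congr rfl fun i _ =>
      (Set.ncard_image_of_injective _ (Function.update_injective x i)).trans (hr (x i))]
    simp
  · exact fun _ => Set.toFinite _
  · intro i j hij
    rw [Function.onFun, Set.disjoint_left]
    rintro _ ⟨a, ha, rfl⟩ ⟨b, hb, hab⟩
    have := congrFun hab i
    rw [Function.update_of_ne hij, Function.update_self] at this
    rw [← this] at ha
    exact (SimpleGraph.cycleGraph n).loopless.irrefl _ ha

lemma cycleGraph_ncard_neighborSet (hn : 3 ≤ n) (a : Fin n) :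
    ((SimpleGraph.cycleGraph n).neighborSet a).ncard = 2 := by
  obtain ⟨m, rfl⟩ := Nat.exists_eq_add_of_le' hn
  rw [← SimpleGraph.cycleGraph_degree_three_le (v := a), Set.ncard_eq_toFinset_card']
  rfl

lemma cycleGraph_two_ncard_neighborSet (a : Fin 2) :
    ((SimpleGraph.cycleGraph 2).neighborSet a).ncard = 1 := by
  have : (SimpleGraph.cycleGraph 2).degree a = 1 := by
    rw [SimpleGraph.cycleGraph_degree_two_le (n := 0)]
    fin_cases a <;> rfl
  rw [← this, Set.ncard_eq_toFinset_card']
  rfl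

end Torus

theorem theorem5p1 (d : ℕ) (hd : 1 ≤ d)
    {Ω : ℕ → Type*} [∀ n, MeasurableSpace (Ω n)]
    (P : ∀ n, Measure (Ω n)) [∀ n, IsProbabilityMeasure (P n)]
    (N : ∀ n, (Fin d → Fin n) → ℝ≥0 → Ω n → ℕ)
    (M : ∀ n, ℝ≥0 → Ω n → (Fin d → Fin n) → ℝ)
    (hM : ∀ n, 2 ≤ n → IsMassProcess (torusGraph n d) (P n) (N n) (M n))
    (hstat : ∀ n, 2 ≤ n → IsStationaryProcess (P n) (M n))
    (hmass : ∀ n, 2 ≤ n → ∀ᵐ ω ∂(P n), ∑ x, M n 0 ω x = (n : ℝ) ^ d) :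
    -- the masses are square integrable, with mean 1
    (∀ n, 2 ≤ n → ∀ x : Fin d → Fin n,
      MemLp (fun ω => M n 0 ω x) 2 (P n) ∧ ∫ ω, M n 0 ω x ∂(P n) = 1) ∧
    -- the variance tends to 1
    (∀ ε : ℝ, 0 < ε → ∀ᶠ n in atTop, ∀ x : Fin d → Fin n,
      |Var[fun ω => M n 0 ω x; P n] - 1| < ε) ∧
    -- the covariance at adjacent vertices tends to `-1 / (2 d)`
    (∀ ε : ℝ, 0 < ε → ∀ᶠ n in atTop, ∀ x y : Fin d → Fin n, (torusGraph n d).Adj x y →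
      |cov[fun ω => M n 0 ω x, fun ω => M n 0 ω y; P n] - (-(1 / (2 * (d : ℝ))))| < ε) ∧
    -- the covariance at distinct, nonadjacent vertices tends to 0
    (∀ ε : ℝ, 0 < ε → ∀ᶠ n in atTop, ∀ x y : Fin d → Fin n,
      x ≠ y → ¬ (torusGraph n d).Adj x y →
      |cov[fun ω => M n 0 ω x, fun ω => M n 0 ω y; P n]| < ε) := by
  have hmass' : ∀ n, 2 ≤ n →
      ∀ᵐ ω ∂(P n), ∑ x, M n 0 ω x = Fintype.card (Fin d → Fin n) := fun n hn => by
    filter_upwards [hmass n hn] with ω h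
    rw [h]
    simp
  -- The degree is 2d only from n = 3 on; there the formula is exact, so each limit is attained,
  -- uniformly in the vertices.
  have hcov : ∀ n, 3 ≤ n → ∀ x y : Fin d → Fin n,
      cov[fun ω => M n 0 ω x, fun ω => M n 0 ω y; P n]
        = -jumpRate (torusGraph n d) (d * 2) x y := fun n hn x y =>
    (hM n (by omega)).covariance_eq (by omega)
      (torusGraph_ncard_neighborSet (cycleGraph_ncard_neighborSet hn))
      (torusGraph_connected (by omega)) (hstat n (by omega)) (hmass' n (by omega)) x y
  refine ⟨fun n hn x => ⟨(hM n hn).memLp (hmass' n hn) x 2, ?_⟩, fun ε hε => ?_, fun ε hε => ?_,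
    fun ε hε => ?_⟩
  -- The mean is also claimed for n = 2, where each cycle is an edge and the degree is d.
  · obtain ⟨r, hr0, hr⟩ : ∃ r, 0 < r ∧
        ∀ a, ((SimpleGraph.cycleGraph n).neighborSet a).ncard = r := by
      rcases hn.eq_or_lt with rfl | h
      · exact ⟨1, one_pos, cycleGraph_two_ncard_neighborSet⟩
      · exact ⟨2, two_pos, cycleGraph_ncard_neighborSet h⟩
    exact (hM n hn).integral_eq_one (Nat.mul_pos hd hr0) (torusGraph_ncard_neighborSet hr)
      (torusGraph_connected (by omega)) (hstat n hn) (hmass' n hn) x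
  · filter_upwards [eventually_ge_atTop 3] with n hn x
    rw [← covariance_self (((hM n (by omega)).memLp (hmass' n (by omega)) x 2).aemeasurable),
      hcov n hn, jumpRate_self]
    simpa using hε
  · filter_upwards [eventually_ge_atTop 3] with n hn x y hxy
    rw [hcov n hn, jumpRate_of_adj _ _ hxy]
    simpa [mul_comm] using hε
  · filter_upwards [eventually_ge_atTop 3] with n hn x y hne hxy
    rw [hcov n hn, jumpRate_of_not_adj _ _ hne hxy]
    simpa using hε
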